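/- For positive integers $a\le b$ let $[a,b]=\{a,a+1,\dots,b\}$ and $[a]=[1,a]$, and let $\binom{X}{k}$ be the family of all $k$-subsets of $X$. A family of sets is intersecting if no two of its members are disjoint. For integers $0<k\le n<2k<m$, an $(m,n,k)$-intersecting family is an intersecting family $\mathcal F$ with $\binom{[n]}{k}\subseteq\mathcal F\subseteq\binom{[m]}{k}$; let $\alpha(m,n,k)$ be the maximum cardinality of such a family, and call an $(m,n,k)$-intersecting family maximum if it has $\alpha(m,n,k)$ members. Put $$h(m,n,k)=\binom{n}{k}+\sum_{i=1}^{2k-n-1}\binom{n-1}{k-i-1}\binom{m-n}{i}$$ and, for $t\in[n]$, $$\mathcal H_t=\binom{[n]}{k}\cup\bigcup_{i=1}^{2k-n-1}\left\{A\cup B\cup\{t\} : A\in\binom{[n]\setminus\{t\}}{k-i-1},\ B\in\binom{[n+1,m]}{i}\right\}.$$ Theorem. Let $m,n,k$ be integers with $0<k\le n<2k<m$ and $n=2k-3$. Then $\alpha(m,n,k)=h(m,n,k)$, and every maximum $(m,n,k)$-intersecting family equals $\mathcal H_t$ for some $t\in[n]$. -/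

import Mathlib

open Finset

/-- An `(m,n,k)`-intersecting family: an intersecting family `F` of `k`-subsets of
`[m] = {1, …, m}` that contains every `k`-subset of `[n] = {1, …, n}`. -/
def IsMNKIntersecting (m n k : ℕ) (F : Finset (Finset ℕ)) : Prop :=
  powersetCard k (Icc 1 n) ⊆ F ∧ F ⊆ powersetCard k (Icc 1 m) ∧
    (F : Set (Finset ℕ)).Intersecting

open Classical in
/-- `α(m,n,k)`: the maximum cardinality of an `(m,n,k)`-intersecting family.
The maximum runs over the finitely many families of `k`-subsets of `[m]`; for
`0 < k ≤ n < 2k ≤ m` at least one of them is `(m,n,k)`-intersecting. -/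
noncomputable def mnkAlpha (m n k : ℕ) : ℕ :=
  ((powersetCard k (Icc 1 m)).powerset.filter (IsMNKIntersecting m n k)).sup card

/-- A maximum `(m,n,k)`-intersecting family: one of cardinality `α(m,n,k)`. -/
def IsMaximumMNK (m n k : ℕ) (F : Finset (Finset ℕ)) : Prop :=
  IsMNKIntersecting m n k F ∧ F.card = mnkAlpha m n k

/-- The family `H_t^{m,n,k}`: all `k`-subsets of `[n]`, together with all sets `A ∪ B ∪ {t}` where,
for some `1 ≤ i ≤ 2k-n-1`, `A` is a `(k-i-1)`-subset of `[n] \ {t}` and `B` is an `i`-subset of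
`[n+1,m]`. (For `0 < k ≤ n < 2k` none of the subtractions truncates.) -/
def mnkH (m n k t : ℕ) : Finset (Finset ℕ) :=
  powersetCard k (Icc 1 n) ∪
    (Icc 1 (2 * k - n - 1)).biUnion fun i =>
      image₂ (fun A B => A ∪ B ∪ {t})
        (powersetCard (k - i - 1) (Icc 1 n \ {t})) (powersetCard i (Icc (n + 1) m))

/-- The number `h(m,n,k)`. -/
def mnkh (m n k : ℕ) : ℕ :=
  n.choose k + ∑ i ∈ Icc 1 (2 * k - n - 1), (n - 1).choose (k - i - 1) * (m - n).choose i

/-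
Write `n = 2s + 1` and `k = s + 2`, and split a family `F` by the traces `f ∩ [n]` of its members.
Every trace has at least `s` elements, and the traces with `s + 2` elements account for the
`k`-subsets of `[n]`. Pair each `s`-set `A ⊆ [n]` with its complement: the parts outside `[n]` of
the members with trace `A` are edges on `[n + 1, m]`, those with trace `[n] \ A` are single
vertices, and every such edge contains every such vertex. With `N = m - n ≥ 4`, the pair therefore
contributes at most `N` when the edges pairwise meet, and at most `N.choose 2` otherwise. Two
disjoint `s`-sets cannot both contribute more than `N`, so by Erdős–Ko–Rado at most
`(2s).choose (s - 1)` of them do, and summing up gives `h(m,n,k)`.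

For uniqueness one needs the extremal case of Erdős–Ko–Rado for `s`-subsets of `ZMod (2s + 1)`,
which Katona's averaging provides. The arcs `{i, i + 2, …, i + 2(s - 1)}` form a closed walk of odd
length `2s + 1` whose consecutive members are disjoint, so an intersecting family `J` contains at
most `s` of them; if `J` has maximum size, averaging over all permutations shows that it contains
exactly `s` arcs of every relabelled walk, so each such walk has exactly one pair of consecutive
arcs outside `J`. Hence if `B` and `C` are disjoint `s`-sets outside `J` and `p` is the remaining
point, exchanging elements keeps them outside `J`, and so every member of `J` contains `p`. In a
maximum family the `s`-sets contributing more than `N` are thus those containing some `t`, and every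
pair outside `[n]` completes each of them to a member. A member not inside `[n]` that misses `t`
would be disjoint from one of these, so `F ⊆ mnkH m n k t`.
-/

open scoped Pointwise

section Averaging

variable {G X : Type*} [Group G] [Fintype G] [MulAction G X] [DecidableEq X]

theorem card_filter_smul_eq {x y : X} (hy : y ∈ MulAction.orbit G x) :
    #{g : G | g • x = y} = Nat.card (MulAction.stabilizer G x) := by
  obtain ⟨h, rfl⟩ := hy
  rw [Nat.card_eq_fintype_card, Fintype.card_subtype]
  exact card_bij' (fun g _ => h⁻¹ * g) (fun g _ => h * g) (by simp [mul_smul, inv_smul_eq_iff])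
    (by simp [mul_smul, MulAction.mem_stabilizer_iff]) (by simp) (by simp)

theorem card_orbit_mul_card_filter_smul_mem {x : X} {S : Finset X}
    (hS : ∀ y ∈ S, y ∈ MulAction.orbit G x) :
    Nat.card (MulAction.orbit G x) * #{g : G | g • x ∈ S} = Nat.card G * #S := by
  have hfib : #{g : G | g • x ∈ S} = #S * Nat.card (MulAction.stabilizer G x) := by
    rw [card_eq_sum_card_fiberwise (f := fun g => g • x) (t := S) (by intro g hg; simpa using hg)]
    refine sum_const_nat fun y hy => ?_
    rw [filter_filter, ← card_filter_smul_eq (hS y hy)]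
    congr 1
    ext g
    simp +contextual [hy]
  rw [hfib, Nat.card_congr (MulAction.orbitEquivQuotientStabilizer G x),
    ← (MulAction.stabilizer G x).card_mul_index, Subgroup.index]
  ring

end Averaging

theorem disjoint_smul_finset {G X : Type*} [Group G] [MulAction G X] [DecidableEq X] {g : G}
    {A B : Finset X} : Disjoint (g • A) (g • B) ↔ Disjoint A B := by
  rw [← disjoint_coe, coe_smul_finset, coe_smul_finset, Set.disjoint_smul_set, disjoint_coe]

section PermFinset

variable {β : Type*} [DecidableEq β]

theorem orbit_perm_finset (A : Finset β) :
    MulAction.orbit (Equiv.Perm β) A = Set.powersetCard β #A := by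
  ext B
  constructor
  · rintro ⟨g, rfl⟩
    exact card_smul_finset g A
  · intro hB
    have := Set.powersetCard.isPretransitive (α := β) (n := #A)
    obtain ⟨g, hg⟩ := MulAction.exists_smul_eq (Equiv.Perm β)
      (⟨A, rfl⟩ : Set.powersetCard β #A) ⟨B, hB⟩
    exact ⟨g, congrArg Subtype.val hg⟩

theorem choose_mul_sum_card_filter_smul_mem [Fintype β] {ι : Type*} [Fintype ι] {r : ℕ}
    {a : ι → Finset β} (ha : ∀ i, #(a i) = r) {J : Finset (Finset β)}
    (hJ : (J : Set (Finset β)).Sized r) :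
    (Fintype.card β).choose r * ∑ g : Equiv.Perm β, #{i | g • a i ∈ J} =
      Fintype.card (Equiv.Perm β) * (Fintype.card ι * #J) := by
  have hfib (i : ι) : (Fintype.card β).choose r * #{g : Equiv.Perm β | g • a i ∈ J} =
      Fintype.card (Equiv.Perm β) * #J := by
    have hS : ∀ B ∈ J, B ∈ MulAction.orbit (Equiv.Perm β) (a i) := fun B hB => by
      rw [orbit_perm_finset, ha]
      exact hJ hB
    have h := card_orbit_mul_card_filter_smul_mem hS
    rwa [orbit_perm_finset, ha, Set.powersetCard.card, Nat.card_eq_fintype_card,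
      Nat.card_eq_fintype_card] at h
  calc (Fintype.card β).choose r * ∑ g : Equiv.Perm β, #{i | g • a i ∈ J}
      = (Fintype.card β).choose r * ∑ i, #{g : Equiv.Perm β | g • a i ∈ J} := by
        congr 1
        exact sum_card_bipartiteAbove_eq_sum_card_bipartiteBelow _
    _ = Fintype.card (Equiv.Perm β) * (Fintype.card ι * #J) := by
        rw [mul_sum, sum_congr rfl fun i _ => hfib i, sum_const, card_univ, smul_eq_mul]
        ring

theorem exists_perm_smul_eq_and_smul_eq [Finite β] {X Y X' Y' : Finset β} (hX : #X = #X')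
    (hY : #Y = #Y') (hXY : #(X ∩ Y) = #(X' ∩ Y')) :
    ∃ g : Equiv.Perm β, g • X = X' ∧ g • Y = Y' := by
  have := Fintype.ofFinite β
  let colour (X Y : Finset β) (x : β) : Bool × Bool := (decide (x ∈ X), decide (x ∈ Y))
  have hfib (c : Bool × Bool) :
      Fintype.card {x // colour X Y x = c} = Fintype.card {x // colour X' Y' x = c} := by
    have hfilter (X Y : Finset β) : univ.filter (fun x => colour X Y x = c) =
        (if c.1 then X else Xᶜ) ∩ (if c.2 then Y else Yᶜ) := by
      ext x
      rcases c with ⟨_ | _, _ | _⟩ <;> simp [colour]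
    rw [Fintype.card_subtype, Fintype.card_subtype, hfilter, hfilter]
    have hYX : #(Y ∩ X) = #(Y' ∩ X') := by rw [inter_comm, hXY, inter_comm]
    rcases c with ⟨_ | _, _ | _⟩ <;> simp only [if_true, Bool.false_eq_true, if_false]
    · rw [← compl_union, ← compl_union, card_compl, card_compl, card_union, card_union, hX, hY, hXY]
    · rw [inter_comm, inter_comm X'ᶜ, ← sdiff_eq_inter_compl, ← sdiff_eq_inter_compl, card_sdiff,
        card_sdiff, hY, hXY]
    · rw [← sdiff_eq_inter_compl, ← sdiff_eq_inter_compl, card_sdiff, card_sdiff, hX, hYX]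
    · exact hXY
  let g : Equiv.Perm β := Equiv.ofFiberEquiv fun c => Fintype.equivOfCardEq (hfib c)
  have hg (x : β) : (g x ∈ X' ↔ x ∈ X) ∧ (g x ∈ Y' ↔ x ∈ Y) := by
    have := Equiv.ofFiberEquiv_map (fun c => Fintype.equivOfCardEq (hfib c)) x
    simpa only [colour, Prod.mk.injEq, decide_eq_decide] using this
  have hmem {S S' : Finset β} (h : ∀ x, g x ∈ S' ↔ x ∈ S) : g • S = S' := by
    ext y
    rw [← inv_smul_mem_iff, Equiv.Perm.smul_def, ← h, ← Equiv.Perm.mul_apply, mul_inv_cancel,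
      Equiv.Perm.one_apply]
  exact ⟨g, hmem fun x => (hg x).1, hmem fun x => (hg x).2⟩

end PermFinset

theorem card_filter_notMem_apply_notMem_add {ι : Type*} [Fintype ι] [DecidableEq ι]
    (σ : Equiv.Perm ι) {M : Finset ι} (hM : ∀ i ∈ M, σ i ∉ M) :
    #{i | i ∉ M ∧ σ i ∉ M} + 2 * #M = Fintype.card ι := by
  have hdisj : Disjoint M (M.map σ.symm.toEmbedding) :=
    disjoint_left.2 fun i hi hi' => hM i hi (by simpa [mem_map_equiv] using hi')
  have hcompl : ({i | i ∉ M ∧ σ i ∉ M} : Finset ι) = (M ∪ M.map σ.symm.toEmbedding)ᶜ := by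
    ext i
    simp [mem_map_equiv]
  have := card_compl_add_card (M ∪ M.map σ.symm.toEmbedding)
  rw [← hcompl, card_union_of_disjoint hdisj, card_map] at this
  omega

theorem powersetCard_induction_swap {α : Type*} [DecidableEq α] {P : Finset α → Prop}
    {U B W : Finset α} (hB : P B)
    (swap : ∀ B x y, P B → x ∈ B → y ∈ U → y ∉ B → P (insert y (B.erase x)))
    (hWU : W ⊆ U) (hW : #W = #B) : P W := by
  induction hd : #(W \ B) generalizing B with
  | zero =>
    rw [card_eq_zero, sdiff_eq_empty_iff_subset] at hd
    rwa [eq_of_subset_of_card_le hd hW.ge]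
  | succ d ih =>
    obtain ⟨y, hy⟩ : (W \ B).Nonempty := card_pos.1 (by omega)
    obtain ⟨x, hx⟩ : (B \ W).Nonempty := card_pos.1 (by rw [card_sdiff_comm hW.symm]; omega)
    rw [mem_sdiff] at hx hy
    refine ih (swap B x y hB hx.1 (hWU hy.1) hy.2) ?_ ?_
    · rw [card_insert_of_notMem (by simp [hy.2]), card_erase_add_one hx.1, hW]
    · have : W \ insert y (B.erase x) = (W \ B).erase y := by
        ext z
        grind
      rw [this, card_erase_of_mem (mem_sdiff.2 hy), hd, Nat.add_sub_cancel]

/-- The arc `{i, i + 2, …, i + 2(s - 1)}` of `ZMod (2s + 1)`. Consecutive arcs are disjoint, so the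
arcs form a closed odd walk in the graph of disjoint `s`-subsets of `ZMod (2s + 1)`. -/
def arc (s : ℕ) (i : ZMod (2 * s + 1)) : Finset (ZMod (2 * s + 1)) :=
  (range s).image fun j => i + (2 * j : ℕ)

section Arc

variable {s : ℕ}

theorem card_arc (i : ZMod (2 * s + 1)) : #(arc s i) = s := by
  rw [arc, card_image_of_injOn, card_range]
  intro a ha b hb hab
  rw [coe_range, Set.mem_Iio] at ha hb
  have := CharP.natCast_injOn_Iio (ZMod (2 * s + 1)) (2 * s + 1) (by grind) (by grind)
    (add_left_cancel hab)
  omega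

theorem disjoint_arc_arc_add_one (i : ZMod (2 * s + 1)) : Disjoint (arc s i) (arc s (i + 1)) := by
  rw [disjoint_left]
  intro x hx hx'
  obtain ⟨a, ha, rfl⟩ := mem_image.1 hx
  obtain ⟨b, hb, hab⟩ := mem_image.1 hx'
  rw [mem_range] at ha hb
  rw [add_assoc, ← Nat.cast_one_add] at hab
  have := CharP.natCast_injOn_Iio (ZMod (2 * s + 1)) (2 * s + 1) (by grind) (by grind)
    (add_left_cancel hab)
  omega

theorem arc_ne_arc_add_two (hs : 0 < s) (i : ZMod (2 * s + 1)) : arc s i ≠ arc s (i + 2) := by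
  intro h
  have hi : i ∈ arc s (i + 2) := h ▸ mem_image.2 ⟨0, mem_range.2 hs, by simp⟩
  obtain ⟨a, ha, hia⟩ := mem_image.1 hi
  rw [mem_range] at ha
  have hz : ((2 + 2 * a : ℕ) : ZMod (2 * s + 1)) = (0 : ℕ) := by
    apply add_left_cancel (a := i)
    push_cast at hia ⊢
    rw [← add_assoc, hia, add_zero]
  have := CharP.natCast_injOn_Iio (ZMod (2 * s + 1)) (2 * s + 1) (by grind) (by grind) hz
  omega

end Arc

section UniqueExtremalOdd

variable {s : ℕ}

theorem card_inter_and_eq_compl_union {β : Type*} [Fintype β] [DecidableEq β]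
    (hβ : Fintype.card β = 2 * s + 1) {B C C' : Finset β} (hB : #B = s) (hC : #C = s)
    (hC' : #C' = s) (hBC : Disjoint B C) (hBC' : Disjoint B C') (hne : C ≠ C') :
    #(C ∩ C') = s - 1 ∧ B = (C ∪ C')ᶜ := by
  have hsub : B ⊆ (C ∪ C')ᶜ :=
    subset_compl_iff_disjoint_right.2 (disjoint_union_right.2 ⟨hBC, hBC'⟩)
  have hlt : #(C ∩ C') < s := by
    rw [← hC]
    refine card_lt_card ⟨inter_subset_left, fun h => hne ?_⟩
    exact eq_of_subset_of_card_le (subset_inter_iff.1 h).2 (hC'.trans hC.symm).le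
  have hunion := card_union_add_card_inter C C'
  have hle := card_le_card hsub
  rw [card_compl, hβ] at hle
  refine ⟨by omega, eq_of_subset_of_card_le hsub ?_⟩
  rw [card_compl, hβ]
  omega

variable {J : Finset (Finset (ZMod (2 * s + 1)))}

/-- The positions at which two consecutive arcs of the walk relabelled by `g` both lie outside
`J`. -/
def gaps (J : Finset (Finset (ZMod (2 * s + 1)))) (g : Equiv.Perm (ZMod (2 * s + 1))) :
    Finset (ZMod (2 * s + 1)) :=
  {i | g • arc s i ∉ J ∧ g • arc s (i + 1) ∉ J}

theorem card_gaps_add_two_mul_card_arcs (hJ : (J : Set (Finset (ZMod (2 * s + 1)))).Intersecting)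
    (g : Equiv.Perm (ZMod (2 * s + 1))) :
    #(gaps J g) + 2 * #{i | g • arc s i ∈ J} = 2 * s + 1 := by
  have hM : ∀ i ∈ ({i | g • arc s i ∈ J} : Finset (ZMod (2 * s + 1))),
      Equiv.addRight 1 i ∉ ({i | g • arc s i ∈ J} : Finset (ZMod (2 * s + 1))) := by
    intro i hi hi'
    rw [mem_filter_univ] at hi hi'
    exact hJ hi hi' (disjoint_smul_finset.2 (disjoint_arc_arc_add_one i))
  simpa [gaps, ZMod.card] using card_filter_notMem_apply_notMem_add (Equiv.addRight 1) hM

theorem card_gaps_eq_one (hs : 0 < s) (hJ : (J : Set (Finset (ZMod (2 * s + 1)))).Intersecting)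
    (hJs : (J : Set (Finset (ZMod (2 * s + 1)))).Sized s) (hcard : #J = (2 * s).choose (s - 1))
    (g : Equiv.Perm (ZMod (2 * s + 1))) :
    #(gaps J g) = 1 := by
  have hgaps := card_gaps_add_two_mul_card_arcs hJ
  have hle : ∀ g ∈ (univ : Finset (Equiv.Perm (ZMod (2 * s + 1)))),
      #{i | g • arc s i ∈ J} ≤ s := fun g _ => by have := hgaps g; omega
  have hchoose : (2 * s + 1) * #J = (2 * s + 1).choose s * s := by
    obtain ⟨r, rfl⟩ := Nat.exists_eq_add_one.2 hs
    rw [hcard, Nat.add_sub_cancel, Nat.add_one_mul_choose_eq]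
  have hsum : ∑ g : Equiv.Perm (ZMod (2 * s + 1)), #{i | g • arc s i ∈ J} =
      ∑ _g : Equiv.Perm (ZMod (2 * s + 1)), s := by
    have h := choose_mul_sum_card_filter_smul_mem card_arc hJs
    rw [ZMod.card, hchoose, mul_left_comm] at h
    rw [sum_const, card_univ, smul_eq_mul]
    exact Nat.eq_of_mul_eq_mul_left (Nat.choose_pos (by omega)) h
  have := hgaps g
  have := (sum_eq_sum_iff_of_le hle).1 hsum g (mem_univ g)
  omega

theorem eq_of_disjoint_of_notMem (hs : 0 < s) (hgap : ∀ g, #(gaps J g) = 1)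
    {B C C' : Finset (ZMod (2 * s + 1))} (hBs : #B = s) (hCs : #C = s) (hCs' : #C' = s)
    (hB : B ∉ J) (hC : C ∉ J) (hC' : C' ∉ J) (hBC : Disjoint B C) (hBC' : Disjoint B C') :
    C = C' := by
  by_contra hne
  obtain ⟨hinter, hBeq⟩ := card_inter_and_eq_compl_union (ZMod.card _) hBs hCs hCs' hBC hBC' hne
  have hdisj₁₂ : Disjoint (arc s 1) (arc s 2) := by
    simpa only [one_add_one_eq_two] using disjoint_arc_arc_add_one (1 : ZMod (2 * s + 1))
  have hdisj₁₀ : Disjoint (arc s 1) (arc s 0) := by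
    simpa only [zero_add] using (disjoint_arc_arc_add_one (0 : ZMod (2 * s + 1))).symm
  have harc : arc s 0 ≠ arc s 2 := by simpa only [zero_add] using arc_ne_arc_add_two hs 0
  have harcInter := (card_inter_and_eq_compl_union (ZMod.card _) (card_arc 1)
    (card_arc 0) (card_arc 2) hdisj₁₀ hdisj₁₂ harc).1
  -- The walk relabelled so that it runs through `C`, `B`, `C'` has two gaps.
  obtain ⟨g, h₀, h₂⟩ := exists_perm_smul_eq_and_smul_eq ((card_arc 0).trans hCs.symm)
    ((card_arc 2).trans hCs'.symm) (harcInter.trans hinter.symm)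
  have h₁ : g • arc s 1 = B := by
    rw [hBeq]
    refine (card_inter_and_eq_compl_union (ZMod.card _) ?_ hCs hCs' ?_ ?_ hne).2
    · rw [card_smul_finset, card_arc]
    · exact h₀ ▸ disjoint_smul_finset.2 hdisj₁₀
    · exact h₂ ▸ disjoint_smul_finset.2 hdisj₁₂
  have hgaps : {0, 1} ⊆ gaps J g := by
    simp [gaps, insert_subset_iff, one_add_one_eq_two, h₀, h₁, h₂, hB, hC, hC']
  have : Fact (1 < 2 * s + 1) := ⟨by omega⟩
  have := card_le_card hgaps
  rw [hgap g, card_pair zero_ne_one] at this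
  omega

theorem insert_erase_mem_of_disjoint_of_notMem (hs : 0 < s) (hgap : ∀ g, #(gaps J g) = 1)
    {B C : Finset (ZMod (2 * s + 1))} {p x : ZMod (2 * s + 1)} (hBs : #B = s) (hCs : #C = s)
    (hB : B ∉ J) (hC : C ∉ J) (hBC : Disjoint B C) (hpB : p ∉ B) (hpC : p ∉ C) (hx : x ∈ B) :
    insert p (B.erase x) ∈ J := by
  by_contra hmem
  have hcard : #(insert p (B.erase x)) = s := by
    rw [card_insert_of_notMem fun h => hpB (mem_of_mem_erase h), card_erase_add_one hx, hBs]
  have hdisj : Disjoint C (insert p (B.erase x)) :=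
    disjoint_insert_right.2 ⟨hpC, hBC.symm.mono_right (erase_subset x B)⟩
  have heq := eq_of_disjoint_of_notMem hs hgap hCs hBs hcard hC hB hmem hBC.symm hdisj
  exact hpB (heq ▸ mem_insert_self p _)

theorem notMem_insert_erase_and_notMem_compl (hs : 0 < s)
    (hJ : (J : Set (Finset (ZMod (2 * s + 1)))).Intersecting)
    (hgap : ∀ g, #(gaps J g) = 1)
    {B : Finset (ZMod (2 * s + 1))} {p x y : ZMod (2 * s + 1)} (hBs : #B = s)
    (hB : B ∉ J) (hC : (insert p B)ᶜ ∉ J) (hpB : p ∉ B) (hx : x ∈ B) (hyp : y ≠ p) (hyB : y ∉ B) :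
    insert y (B.erase x) ∉ J ∧ (insert p (insert y (B.erase x)))ᶜ ∉ J := by
  have hCs : #(insert p B)ᶜ = s := by
    rw [card_compl, ZMod.card, card_insert_of_notMem hpB, hBs]
    omega
  have hpC : p ∉ (insert p B)ᶜ := by simp
  have hyC : y ∈ (insert p B)ᶜ := by simp [hyp, hyB]
  have hBC : Disjoint B (insert p B)ᶜ := disjoint_compl_right.mono_left (subset_insert p B)
  have hB₁ := insert_erase_mem_of_disjoint_of_notMem hs hgap hBs hCs hB hC hBC hpB hpC hx
  have hC₁ := insert_erase_mem_of_disjoint_of_notMem hs hgap hCs hBs hC hB hBC.symm hpC hpB hyC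
  refine ⟨fun h => hJ h hC₁ ?_, fun h => hJ hB₁ h ?_⟩
  · rw [disjoint_left]
    grind [mem_compl]
  · exact disjoint_compl_right.mono_left (insert_subset_insert p (subset_insert y _))

theorem exists_forall_mem_of_card_eq_choose (hs : 0 < s)
    (hJ : (J : Set (Finset (ZMod (2 * s + 1)))).Intersecting)
    (hJs : (J : Set (Finset (ZMod (2 * s + 1)))).Sized s) (hcard : #J = (2 * s).choose (s - 1)) :
    ∃ p, ∀ A ∈ J, p ∈ A := by
  have hgap := card_gaps_eq_one hs hJ hJs hcard
  obtain ⟨i, hi⟩ : (gaps J 1).Nonempty := card_pos.1 (by rw [hgap]; exact one_pos)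
  simp only [gaps, one_smul, mem_filter_univ] at hi
  obtain ⟨hB, hC⟩ := hi
  have hcompl : #(arc s i ∪ arc s (i + 1))ᶜ = 1 := by
    rw [card_compl, ZMod.card, card_union_of_disjoint (disjoint_arc_arc_add_one i), card_arc,
      card_arc]
    omega
  obtain ⟨p, hp⟩ := card_eq_one.1 hcompl
  have hmem (x : ZMod (2 * s + 1)) : x ∉ arc s i ∧ x ∉ arc s (i + 1) ↔ x = p := by
    rw [← mem_singleton, ← hp, mem_compl, mem_union, not_or]
  have hCeq : (insert p (arc s i))ᶜ = arc s (i + 1) := by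
    have := disjoint_left.1 (disjoint_arc_arc_add_one i)
    ext x
    rw [mem_compl, mem_insert, ← hmem]
    grind
  refine ⟨p, fun A hA => by_contra fun hpA => ?_⟩
  refine (powersetCard_induction_swap (U := univ.erase p)
    (P := fun B => (B ∉ J ∧ (insert p B)ᶜ ∉ J) ∧ #B = s ∧ p ∉ B)
    ⟨⟨hB, hCeq ▸ hC⟩, card_arc i, ((hmem p).2 rfl).1⟩ ?_ (subset_erase.2 ⟨subset_univ A, hpA⟩)
    ((hJs hA).trans (card_arc i).symm)).1.1 hA
  rintro B x y ⟨⟨hB, hC⟩, hBs, hpB⟩ hx hy hyB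
  have hyp := ne_of_mem_erase hy
  refine ⟨notMem_insert_erase_and_notMem_compl hs hJ hgap hBs hB hC hpB hx hyp hyB, ?_, ?_⟩
  · rw [card_insert_of_notMem fun h => hyB (mem_of_mem_erase h), card_erase_add_one hx, hBs]
  · simp [hyp.symm, hpB]

end UniqueExtremalOdd

section ErdosKoRado

variable {α : Type*} [DecidableEq α] {J : Finset (Finset α)} {U : Finset α} {r s : ℕ}

theorem exists_intersecting_sized_map_eq {β : Type*} [Fintype β] [DecidableEq β] (φ : β ↪ α)
    (hJ : (J : Set (Finset α)).Intersecting) (hJr : J ⊆ powersetCard r (univ.map φ)) :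
    ∃ K : Finset (Finset β), (K : Set (Finset β)).Intersecting ∧
      (K : Set (Finset β)).Sized r ∧ J = K.map (mapEmbedding φ).toEmbedding := by
  refine ⟨univ.filter fun A => A.map φ ∈ J, fun A hA B hB hAB => ?_, fun A hA => ?_, ?_⟩
  · exact hJ (mem_filter.1 hA).2 (mem_filter.1 hB).2 ((disjoint_map φ).2 hAB)
  · rw [← (mem_powersetCard.1 (hJr (mem_filter.1 hA).2)).2, card_map]
  · ext A
    constructor
    · intro hA
      obtain ⟨B, -, rfl⟩ := subset_map_iff.1 (mem_powersetCard.1 (hJr hA)).1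
      simpa using hA
    · intro hA
      obtain ⟨B, hB, rfl⟩ := mem_map.1 hA
      exact (mem_filter.1 hB).2

theorem card_le_choose_of_intersecting (hJ : (J : Set (Finset α)).Intersecting)
    (hJr : J ⊆ powersetCard r U) (hr : r ≤ #U / 2) : #J ≤ (#U - 1).choose (r - 1) := by
  obtain ⟨φ, hφ⟩ := Function.Embedding.exists_of_card_eq_finset (Fintype.card_fin #U)
  obtain ⟨K, hK, hKr, rfl⟩ := exists_intersecting_sized_map_eq φ hJ (hφ ▸ hJr)
  rw [card_map]
  exact erdos_ko_rado hK hKr hr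

theorem exists_eq_filter_mem_of_card_eq_choose (hs : 0 < s) (hU : #U = 2 * s + 1)
    (hJ : (J : Set (Finset α)).Intersecting) (hJs : J ⊆ powersetCard s U)
    (hcard : #J = (2 * s).choose (s - 1)) : ∃ t ∈ U, J = {A ∈ powersetCard s U | t ∈ A} := by
  obtain ⟨φ, rfl⟩ := Function.Embedding.exists_of_card_eq_finset
    ((ZMod.card (2 * s + 1)).trans hU.symm)
  obtain ⟨K, hK, hKs, rfl⟩ := exists_intersecting_sized_map_eq φ hJ hJs
  rw [card_map] at hcard
  obtain ⟨p, hp⟩ := exists_forall_mem_of_card_eq_choose hs hK hKs hcard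
  have hpU : φ p ∈ univ.map φ := mem_map_of_mem φ (mem_univ p)
  refine ⟨φ p, hpU, eq_of_subset_of_card_le (fun A hA => mem_filter.2 ⟨hJs hA, ?_⟩) ?_⟩
  · obtain ⟨B, hB, rfl⟩ := mem_map.1 hA
    exact mem_map_of_mem φ (hp B hB)
  · have hstar := card_filter_powersetCard_subset {φ p} (univ.map φ) (n := s)
      (singleton_subset_iff.2 hpU) hs
    simp only [singleton_subset_iff, hU, card_singleton, Nat.add_sub_cancel] at hstar
    rw [hstar, card_map, hcard]

end ErdosKoRado

section Graphs

variable {α : Type*}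

/-- Every member of `E` meets every member of `G`: the two-family version of `Set.Intersecting`. -/
def CrossIntersecting (E G : Finset (Finset α)) : Prop :=
  ∀ ⦃e⦄, e ∈ E → ∀ ⦃g⦄, g ∈ G → ¬ Disjoint e g

variable {V : Finset α} {E E' G G' : Finset (Finset α)}

theorem card_add_card_le_of_intersecting [DecidableEq α] (hV : 4 ≤ #V)
    (hE : E ⊆ powersetCard 2 V) (hG : G ⊆ powersetCard 1 V) (hI : (E : Set (Finset α)).Intersecting)
    (hEG : CrossIntersecting E G) : #E + #G ≤ #V := by
  have hEV : #E ≤ #V - 1 := by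
    simpa using card_le_choose_of_intersecting hI hE (by omega)
  rcases E.eq_empty_or_nonempty with rfl | ⟨e, he⟩
  · simpa using card_le_card hG
  have hsub : ∀ e ∈ E, G ⊆ powersetCard 1 e := fun e he g hg => by
    obtain ⟨x, rfl⟩ := card_eq_one.1 (mem_powersetCard.1 (hG hg)).2
    simpa [singleton_subset_iff] using hEG he hg
  have hcard : ∀ e ∈ E, #(powersetCard 1 e) = 2 := fun e he => by
    rw [card_powersetCard, (mem_powersetCard.1 (hE he)).2, Nat.choose_one_right]
  have hG2 := (card_le_card (hsub e he)).trans_eq (hcard e he)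
  obtain hG1 | hGeq := hG2.lt_or_eq
  · omega
  have hE1 : #E ≤ 1 := card_le_one.2 fun e he f hf => by
    have heq : ∀ e ∈ E, G = powersetCard 1 e := fun e he =>
      eq_of_subset_of_card_le (hsub e he) ((hcard e he).trans hGeq.symm).le
    have := (heq e he).symm.trans (heq f hf)
    rwa [powersetCard_one, powersetCard_one, map_inj] at this
  omega

theorem eq_empty_of_not_intersecting [DecidableEq α] (hG : G ⊆ powersetCard 1 V)
    (hI : ¬ (E : Set (Finset α)).Intersecting) (hEG : CrossIntersecting E G) : G = ∅ := by
  rw [eq_empty_iff_forall_notMem]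
  intro g hg
  obtain ⟨x, rfl⟩ := card_eq_one.1 (mem_powersetCard.1 (hG hg)).2
  have hx : ∀ e ∈ E, x ∈ e := fun e he => by simpa using hEG he hg
  exact hI fun e he f hf hef => disjoint_left.1 hef (hx e he) (hx f hf)

theorem card_le_four_of_not_intersecting [DecidableEq α] (hE : E ⊆ powersetCard 2 V)
    (hE' : E' ⊆ powersetCard 2 V)
    (hEE' : CrossIntersecting E E') (hI : ¬ (E : Set (Finset α)).Intersecting) : #E' ≤ 4 := by
  simp only [Set.Intersecting, not_forall, not_not, mem_coe] at hI
  obtain ⟨e, he, f, hf, hef⟩ := hI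
  have hsub : E' ⊆ image₂ (fun x y => {x, y}) e f := by
    intro d hd
    obtain ⟨x, hxe, hxd⟩ := not_disjoint_iff.1 (hEE' he hd)
    obtain ⟨y, hyf, hyd⟩ := not_disjoint_iff.1 (hEE' hf hd)
    have hxy : x ≠ y := fun h => disjoint_left.1 hef hxe (h ▸ hyf)
    refine mem_image₂.2 ⟨x, hxe, y, hyf, eq_of_subset_of_card_le ?_ ?_⟩
    · simp [insert_subset_iff, hxd, hyd]
    · rw [(mem_powersetCard.1 (hE' hd)).2, card_pair hxy]
  calc #E' ≤ #(image₂ (fun x y => {x, y}) e f) := card_le_card hsub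
    _ ≤ #e * #f := card_image₂_le _ _ _
    _ = 4 := by rw [(mem_powersetCard.1 (hE he)).2, (mem_powersetCard.1 (hE hf)).2]

theorem card_add_card_le_of_crossIntersecting (hV : 4 ≤ #V) (hE : E ⊆ powersetCard 2 V)
    (hE' : E' ⊆ powersetCard 2 V) (hG : G ⊆ powersetCard 1 V) (hG' : G' ⊆ powersetCard 1 V)
    (hEG : CrossIntersecting E G) (hEG' : CrossIntersecting E' G') (hEE' : CrossIntersecting E E') :
    #E + #G ≤ #V ∨ #E' + #G' ≤ #V := by
  classical
  by_cases hI : (E : Set (Finset α)).Intersecting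
  · exact Or.inl (card_add_card_le_of_intersecting hV hE hG hI hEG)
  right
  by_cases hI' : (E' : Set (Finset α)).Intersecting
  · exact card_add_card_le_of_intersecting hV hE' hG' hI' hEG'
  rw [eq_empty_of_not_intersecting hG' hI' hEG', card_empty, add_zero]
  exact (card_le_four_of_not_intersecting hE hE' hEE' hI).trans hV

theorem lt_choose_two {n : ℕ} (hn : 4 ≤ n) : n < n.choose 2 := by
  rw [Nat.choose_two_right, Nat.lt_iff_add_one_le, Nat.le_div_iff_mul_le two_pos]
  obtain ⟨r, rfl⟩ := Nat.exists_eq_add_of_le' hn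
  rw [show r + 4 - 1 = r + 3 by omega]
  nlinarith

theorem card_add_card_le_choose_two (hV : 4 ≤ #V) (hE : E ⊆ powersetCard 2 V)
    (hG : G ⊆ powersetCard 1 V) (hEG : CrossIntersecting E G) : #E + #G ≤ (#V).choose 2 := by
  classical
  by_cases hI : (E : Set (Finset α)).Intersecting
  · exact (card_add_card_le_of_intersecting hV hE hG hI hEG).trans (lt_choose_two hV).le
  · rw [eq_empty_of_not_intersecting hG hI hEG, card_empty, add_zero, ← card_powersetCard]
    exact card_le_card hE

theorem eq_powersetCard_two_of_card_add_card_eq (hV : 4 ≤ #V) (hE : E ⊆ powersetCard 2 V)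
    (hG : G ⊆ powersetCard 1 V) (hEG : CrossIntersecting E G)
    (h : #E + #G = (#V).choose 2) : E = powersetCard 2 V := by
  classical
  have hI : ¬ (E : Set (Finset α)).Intersecting := fun hI =>
    (lt_choose_two hV).not_ge (h ▸ card_add_card_le_of_intersecting hV hE hG hI hEG)
  rw [eq_empty_of_not_intersecting hG hI hEG, card_empty, add_zero] at h
  exact eq_of_subset_of_card_le hE (by rw [card_powersetCard, h])

end Graphs

section Link

variable {α : Type*} [DecidableEq α] {F : Finset (Finset α)} {U A B e f : Finset α}

/-- The link of the trace `A`: the parts outside `U` of the members of `F` that meet `U` in `A`. -/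
def traceLink (F : Finset (Finset α)) (U A : Finset α) : Finset (Finset α) :=
  {f ∈ F | f ∩ U = A}.image (· \ U)

/-- The number of members of `F` whose trace on `U` is `A` or its complement `U \ A`. -/
def traceWeight (F : Finset (Finset α)) (U A : Finset α) : ℕ :=
  #(traceLink F U A) + #(traceLink F U (U \ A))

theorem mem_traceLink : e ∈ traceLink F U A ↔ ∃ f ∈ F, f ∩ U = A ∧ f \ U = e := by
  simp [traceLink, and_assoc]

theorem sdiff_mem_traceLink (hf : f ∈ F) : f \ U ∈ traceLink F U (f ∩ U) :=
  mem_traceLink.2 ⟨f, hf, rfl, rfl⟩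

theorem card_eq_sum_traceLink (F : Finset (Finset α)) (U : Finset α) :
    #F = ∑ A ∈ U.powerset, #(traceLink F U A) := by
  rw [card_eq_sum_card_fiberwise (f := (· ∩ U)) (t := U.powerset) (fun f _ => by simp)]
  refine sum_congr rfl fun A _ => (card_image_of_injOn fun f hf g hg hfg => ?_).symm
  simp only [coe_filter, Set.mem_ofPred_eq] at hf hg hfg
  rw [← sdiff_union_inter f U, ← sdiff_union_inter g U, hfg, hf.2, hg.2]

theorem crossIntersecting_traceLink (hF : (F : Set (Finset α)).Intersecting)
    (hAB : Disjoint A B) : CrossIntersecting (traceLink F U A) (traceLink F U B) := by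
  intro e he g hg hd
  obtain ⟨p, hp, rfl, rfl⟩ := mem_traceLink.1 he
  obtain ⟨q, hq, rfl, rfl⟩ := mem_traceLink.1 hg
  refine hF hp hq ?_
  refine disjoint_left.2 fun x hxp hxq => ?_
  by_cases hxU : x ∈ U
  · exact disjoint_left.1 hAB (mem_inter.2 ⟨hxp, hxU⟩) (mem_inter.2 ⟨hxq, hxU⟩)
  · exact disjoint_left.1 hd (mem_sdiff.2 ⟨hxp, hxU⟩) (mem_sdiff.2 ⟨hxq, hxU⟩)

theorem sum_powersetCard_sdiff {M : Type*} [AddCommMonoid M] {a b : ℕ} (hU : #U = a + b)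
    (w : Finset α → M) :
    ∑ B ∈ powersetCard b U, w B = ∑ A ∈ powersetCard a U, w (U \ A) := by
  have hmem {a b : ℕ} (hU : #U = a + b) : ∀ A ∈ powersetCard a U, U \ A ∈ powersetCard b U := by
    intro A hA
    rw [mem_powersetCard] at hA ⊢
    exact ⟨sdiff_subset, by rw [card_sdiff_of_subset hA.1]; omega⟩
  have hinv {a : ℕ} : ∀ A ∈ powersetCard a U, U \ (U \ A) = A := fun A hA =>
    Finset.sdiff_sdiff_eq_self (mem_powersetCard.1 hA).1
  exact sum_nbij' (U \ ·) (U \ ·) (hmem (by omega)) (hmem hU) hinv hinv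
    fun B hB => by rw [hinv B hB]

end Link

section WeightedSum

variable {ι : Type*} {T : Finset ι} {w : ι → ℕ} {N d a : ℕ}

theorem le_add_ite_of_le_add {x : ℕ} (hx : x ≤ N + d) : x ≤ N + if N < x then d else 0 := by
  split_ifs <;> omega

theorem sum_add_ite_eq : ∑ i ∈ T, (N + if N < w i then d else 0) =
    #T * N + #{i ∈ T | N < w i} * d := by
  rw [sum_add_distrib, ← sum_filter, sum_const, sum_const, smul_eq_mul, smul_eq_mul]

theorem sum_le_of_card_filter_lt_le (hw : ∀ i ∈ T, w i ≤ N + d) (ha : #{i ∈ T | N < w i} ≤ a) :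
    ∑ i ∈ T, w i ≤ #T * N + a * d :=
  calc ∑ i ∈ T, w i ≤ ∑ i ∈ T, (N + if N < w i then d else 0) :=
        sum_le_sum fun i hi => le_add_ite_of_le_add (hw i hi)
    _ = #T * N + #{i ∈ T | N < w i} * d := sum_add_ite_eq
    _ ≤ #T * N + a * d := by gcongr

theorem card_filter_lt_eq_of_le_sum (hw : ∀ i ∈ T, w i ≤ N + d) (hd : 0 < d)
    (ha : #{i ∈ T | N < w i} ≤ a) (h : #T * N + a * d ≤ ∑ i ∈ T, w i) :
    #{i ∈ T | N < w i} = a :=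
  ha.antisymm <| Nat.le_of_mul_le_mul_right
    (Nat.add_le_add_iff_left.1 (h.trans (sum_le_of_card_filter_lt_le hw le_rfl))) hd

theorem eq_add_of_le_sum (hw : ∀ i ∈ T, w i ≤ N + d) (ha : #{i ∈ T | N < w i} ≤ a)
    (h : #T * N + a * d ≤ ∑ i ∈ T, w i) {i : ι} (hi : i ∈ T) (hNi : N < w i) :
    w i = N + d := by
  have hle : ∀ i ∈ T, w i ≤ N + if N < w i then d else 0 := fun i hi =>
    le_add_ite_of_le_add (hw i hi)
  have hsum : ∑ i ∈ T, (N + if N < w i then d else 0) ≤ ∑ i ∈ T, w i :=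
    sum_add_ite_eq.le.trans (le_trans (by gcongr) h)
  simpa [hNi] using (sum_eq_sum_iff_of_le hle).1 ((sum_le_sum hle).antisymm hsum) i hi

end WeightedSum

section Families

variable {m n k s t : ℕ} {F : Finset (Finset ℕ)} {A f : Finset ℕ}

theorem lt_add_card_inter_of_mem (hF : IsMNKIntersecting m n k F) (hf : f ∈ F) :
    n < k + #(f ∩ Icc 1 n) := by
  by_contra! hle
  have hk : k ≤ #(Icc 1 n \ f) := by
    rw [card_sdiff, Nat.card_Icc]
    omega
  obtain ⟨g, hg, hgk⟩ := exists_subset_card_eq hk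
  exact hF.2.2 hf (hF.1 (mem_powersetCard.2 ⟨hg.trans sdiff_subset, hgk⟩))
    (disjoint_sdiff.mono_right hg)

theorem sdiff_Icc_subset (hf : f ⊆ Icc 1 m) : f \ Icc 1 n ⊆ Icc (n + 1) m := by
  intro x hx
  have := hf (mem_sdiff.1 hx).1
  grind

theorem traceLink_subset_powersetCard (hF : F ⊆ powersetCard k (Icc 1 m)) :
    traceLink F (Icc 1 n) A ⊆ powersetCard (k - #A) (Icc (n + 1) m) := by
  intro e he
  obtain ⟨f, hf, rfl, rfl⟩ := mem_traceLink.1 he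
  obtain ⟨hfm, hfk⟩ := mem_powersetCard.1 (hF hf)
  have := card_sdiff_add_card_inter f (Icc 1 n)
  exact mem_powersetCard.2 ⟨sdiff_Icc_subset hfm, by omega⟩

theorem traceLink_eq_empty (hF : IsMNKIntersecting m n k F) (hA : k + #A ≤ n ∨ k < #A) :
    traceLink F (Icc 1 n) A = ∅ := by
  rw [eq_empty_iff_forall_notMem]
  intro e he
  obtain ⟨f, hf, rfl, -⟩ := mem_traceLink.1 he
  have hlt := lt_add_card_inter_of_mem hF hf
  have hle := card_le_card (inter_subset_left (s₁ := f) (s₂ := Icc 1 n))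
  rw [(mem_powersetCard.1 (hF.2.1 hf)).2] at hle
  omega

theorem card_le_choose_add_sum_traceWeight (hs : 0 < s)
    (hF : IsMNKIntersecting m (2 * s + 1) (s + 2) F) :
    #F ≤ (2 * s + 1).choose (s + 2) +
      ∑ A ∈ powersetCard s (Icc 1 (2 * s + 1)), traceWeight F (Icc 1 (2 * s + 1)) A := by
  set U := Icc 1 (2 * s + 1) with hU
  have hcU : #U = s + (s + 1) := by
    rw [hU, Nat.card_Icc]
    omega
  have hsizes : ∑ j ∈ range (#U + 1), ∑ A ∈ powersetCard j U, #(traceLink F U A) =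
      ∑ j ∈ {s, s + 1, s + 2}, ∑ A ∈ powersetCard j U, #(traceLink F U A) := by
    refine (sum_subset (by grind) fun j _ hj => sum_eq_zero fun A hA => ?_).symm
    rw [card_eq_zero]
    refine traceLink_eq_empty hF ?_
    rw [(mem_powersetCard.1 hA).2]
    grind
  have htop : ∑ A ∈ powersetCard (s + 2) U, #(traceLink F U A) ≤ (2 * s + 1).choose (s + 2) := by
    have hone : ∀ A ∈ powersetCard (s + 2) U, #(traceLink F U A) ≤ 1 := fun A hA => by
      simpa [(mem_powersetCard.1 hA).2] using
        card_le_card (traceLink_subset_powersetCard (n := 2 * s + 1) (A := A) hF.2.1)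
    simpa [hU] using sum_le_card_nsmul _ _ 1 hone
  rw [card_eq_sum_traceLink F U, sum_powerset, hsizes, sum_insert (by simp), sum_pair (by simp),
    sum_powersetCard_sdiff hcU]
  simp only [traceWeight, sum_add_distrib]
  omega

end Families

section StarFamily

section Pieces

variable {α : Type*} [DecidableEq α] {U V A B f : Finset α} {t : α} {a b : ℕ}

theorem union_union_singleton_inter_sdiff (hUV : Disjoint U V) (hA : A ⊆ U \ {t}) (hB : B ⊆ V) :
    ((A ∪ B ∪ {t}) ∩ U) \ {t} = A := by
  rw [disjoint_left] at hUV
  grind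

theorem union_union_singleton_sdiff (hUV : Disjoint U V) (ht : t ∈ U) (hA : A ⊆ U \ {t})
    (hB : B ⊆ V) : (A ∪ B ∪ {t}) \ U = B := by
  rw [disjoint_left] at hUV
  grind

theorem mem_image₂_union_union_singleton (hUV : Disjoint U V) (ht : t ∈ U) :
    f ∈ image₂ (fun A B => A ∪ B ∪ {t}) (powersetCard a (U \ {t})) (powersetCard b V) ↔
      f ⊆ U ∪ V ∧ t ∈ f ∧ #(f ∩ U) = a + 1 ∧ #(f \ U) = b := by
  have hcard (f : Finset α) (htf : t ∈ f) : #(f ∩ U) = #((f ∩ U) \ {t}) + 1 := by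
    rw [sdiff_singleton_eq_erase, card_erase_add_one (mem_inter.2 ⟨htf, ht⟩)]
  simp only [mem_image₂, mem_powersetCard]
  constructor
  · rintro ⟨A, ⟨hA, rfl⟩, B, ⟨hB, rfl⟩, rfl⟩
    have htf : t ∈ A ∪ B ∪ {t} := mem_union_right _ (mem_singleton_self t)
    rw [hcard _ htf, union_union_singleton_inter_sdiff hUV hA hB,
      union_union_singleton_sdiff hUV ht hA hB]
    exact ⟨by grind, htf, rfl, rfl⟩
  · rintro ⟨hf, htf, hfU, hfV⟩
    rw [hcard f htf] at hfU
    refine ⟨(f ∩ U) \ {t}, ⟨sdiff_subset_sdiff inter_subset_right subset_rfl, by omega⟩,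
      f \ U, ⟨sdiff_le_iff.2 hf, hfV⟩, ?_⟩
    rw [union_right_comm, sdiff_union_of_subset (singleton_subset_iff.2 (mem_inter.2 ⟨htf, ht⟩)),
      union_comm, sdiff_union_inter]

theorem card_image₂_union_union_singleton (hUV : Disjoint U V) (ht : t ∈ U) :
    #(image₂ (fun A B => A ∪ B ∪ {t}) (powersetCard a (U \ {t})) (powersetCard b V)) =
      (#U - 1).choose a * (#V).choose b := by
  rw [card_image₂_iff.2, card_powersetCard, card_powersetCard, sdiff_singleton_eq_erase,
    card_erase_of_mem ht]
  rintro ⟨A, B⟩ hAB ⟨A', B'⟩ hAB' (h : A ∪ B ∪ {t} = A' ∪ B' ∪ {t})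
  simp only [Set.mem_prod, mem_coe, mem_powersetCard] at hAB hAB'
  obtain ⟨⟨hA, -⟩, hB, -⟩ := hAB
  obtain ⟨⟨hA', -⟩, hB', -⟩ := hAB'
  rw [← union_union_singleton_inter_sdiff hUV hA hB, h,
    union_union_singleton_inter_sdiff hUV hA' hB', ← union_union_singleton_sdiff hUV ht hA hB, h,
    union_union_singleton_sdiff hUV ht hA' hB']

end Pieces

variable {m n k t : ℕ} {f : Finset ℕ}

theorem disjoint_Icc_Icc_add_one : Disjoint (Icc 1 n) (Icc (n + 1) m) :=
  disjoint_left.2 fun x hx hx' => by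
    rw [mem_Icc] at hx hx'
    omega

theorem mem_mnkH (ht : t ∈ Icc 1 n) (hkn : k ≤ n) (hnm : n ≤ m) :
    f ∈ mnkH m n k t ↔ f ∈ powersetCard k (Icc 1 m) ∧
      (f ⊆ Icc 1 n ∨ t ∈ f ∧ n < k + #(f ∩ Icc 1 n)) := by
  have hIcc : Icc 1 n ∪ Icc (n + 1) m = Icc 1 m := by
    ext x
    simp only [mem_union, mem_Icc]
    omega
  have hcard := card_sdiff_add_card_inter f (Icc 1 n)
  simp only [mnkH, mem_union, mem_biUnion, mem_powersetCard,
    mem_image₂_union_union_singleton disjoint_Icc_Icc_add_one ht, hIcc]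
  constructor
  · rintro (⟨hf, hfk⟩ | ⟨i, hi, hf, htf, hfn, hfi⟩)
    · exact ⟨⟨hf.trans (Icc_subset_Icc_right hnm), hfk⟩, Or.inl hf⟩
    · rw [mem_Icc] at hi
      exact ⟨⟨hf, by omega⟩, Or.inr ⟨htf, by omega⟩⟩
  · rintro ⟨⟨hf, hfk⟩, hfn | ⟨htf, hlt⟩⟩
    · exact Or.inl ⟨hfn, hfk⟩
    by_cases hfn : f ⊆ Icc 1 n
    · exact Or.inl ⟨hfn, hfk⟩
    have hpos := (sdiff_nonempty.2 hfn).card_pos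
    have := card_pos.2 ⟨t, mem_inter.2 ⟨htf, ht⟩⟩
    exact Or.inr ⟨#(f \ Icc 1 n), mem_Icc.2 ⟨hpos, by omega⟩, hf, htf, by omega, rfl⟩

theorem isMNKIntersecting_mnkH (ht : t ∈ Icc 1 n) (hkn : k ≤ n) (hn : n < 2 * k) (hnm : n ≤ m) :
    IsMNKIntersecting m n k (mnkH m n k t) := by
  have hmem {f : Finset ℕ} := mem_mnkH (f := f) ht hkn hnm
  have hlt : ∀ f ∈ mnkH m n k t, n < k + #(f ∩ Icc 1 n) := fun f hf => by
    obtain ⟨hf, hfn | ⟨-, hlt⟩⟩ := hmem.1 hf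
    · rw [inter_eq_left.2 hfn, (mem_powersetCard.1 hf).2]
      omega
    · exact hlt
  have hmeet : ∀ f ∈ mnkH m n k t, f ⊆ Icc 1 n → ∀ g ∈ mnkH m n k t, ¬ Disjoint f g := by
    intro f hf hfn g hg hd
    have hle := card_le_card (union_subset hfn (inter_subset_right (s₁ := g)))
    rw [card_union_of_disjoint (hd.mono_right inter_subset_left),
      (mem_powersetCard.1 (hmem.1 hf).1).2, Nat.card_Icc] at hle
    have := hlt g hg
    omega
  refine ⟨subset_union_left, fun f hf => (hmem.1 hf).1, fun f hf g hg hd => ?_⟩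
  obtain ⟨-, hfn | ⟨htf, -⟩⟩ := hmem.1 hf
  · exact hmeet f hf hfn g hg hd
  obtain ⟨-, hgn | ⟨htg, -⟩⟩ := hmem.1 hg
  · exact hmeet g hg hgn f hf hd.symm
  · exact disjoint_left.1 hd htf htg

theorem card_mnkH (ht : t ∈ Icc 1 n) : #(mnkH m n k t) = mnkh m n k := by
  rw [mnkH, mnkh, card_union_of_disjoint, card_biUnion, card_powersetCard, Nat.card_Icc,
    Nat.add_sub_cancel]
  · simp only [card_image₂_union_union_singleton disjoint_Icc_Icc_add_one ht, Nat.card_Icc,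
      Nat.add_sub_cancel, Nat.add_sub_add_right]
  · intro i _ j _ hij
    refine disjoint_left.2 fun f hf hf' => hij ?_
    rw [mem_image₂_union_union_singleton disjoint_Icc_Icc_add_one ht] at hf hf'
    exact hf.2.2.2.symm.trans hf'.2.2.2
  · refine disjoint_left.2 fun f hf hf' => ?_
    obtain ⟨i, hi, hfi⟩ := mem_biUnion.1 hf'
    rw [mem_image₂_union_union_singleton disjoint_Icc_Icc_add_one ht,
      sdiff_eq_empty_iff_subset.2 (mem_powersetCard.1 hf).1, card_empty] at hfi
    have := (mem_Icc.1 hi).1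
    omega

end StarFamily

section Maximum

variable {m n k a : ℕ} {F : Finset (Finset ℕ)}

theorem IsMNKIntersecting.card_le_mnkAlpha (hF : IsMNKIntersecting m n k F) :
    #F ≤ mnkAlpha m n k := by
  classical
  exact le_sup (f := card) (mem_filter.2 ⟨mem_powerset.2 hF.2.1, hF⟩)

theorem mnkAlpha_le (h : ∀ F, IsMNKIntersecting m n k F → #F ≤ a) : mnkAlpha m n k ≤ a := by
  classical
  exact Finset.sup_le fun F hF => h F (mem_filter.1 hF).2

end Maximum

section Extremal

variable {m s t : ℕ} {F : Finset (Finset ℕ)} {A : Finset ℕ}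

theorem traceLink_subset_powersetCard_two (hF : F ⊆ powersetCard (s + 2) (Icc 1 m))
    (hA : A ∈ powersetCard s (Icc 1 (2 * s + 1))) :
    traceLink F (Icc 1 (2 * s + 1)) A ⊆ powersetCard 2 (Icc (2 * s + 2) m) := by
  simpa [(mem_powersetCard.1 hA).2] using traceLink_subset_powersetCard (A := A) hF

theorem traceLink_sdiff_subset_powersetCard_one (hF : F ⊆ powersetCard (s + 2) (Icc 1 m))
    (hA : A ∈ powersetCard s (Icc 1 (2 * s + 1))) :
    traceLink F (Icc 1 (2 * s + 1)) (Icc 1 (2 * s + 1) \ A) ⊆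
      powersetCard 1 (Icc (2 * s + 2) m) := by
  obtain ⟨hAU, hAs⟩ := mem_powersetCard.1 hA
  have hcard : s + 2 - #(Icc 1 (2 * s + 1) \ A) = 1 := by
    rw [card_sdiff_of_subset hAU, hAs, Nat.card_Icc]
    omega
  simpa [hcard] using traceLink_subset_powersetCard (A := Icc 1 (2 * s + 1) \ A) hF

theorem card_Icc_two_mul_add_two : #(Icc (2 * s + 2) m) = m - (2 * s + 1) := by
  rw [Nat.card_Icc]
  omega

theorem traceWeight_le_choose_two (hm : 2 * s + 5 ≤ m)
    (hF : IsMNKIntersecting m (2 * s + 1) (s + 2) F)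
    (hA : A ∈ powersetCard s (Icc 1 (2 * s + 1))) :
    traceWeight F (Icc 1 (2 * s + 1)) A ≤ (m - (2 * s + 1)).choose 2 := by
  rw [← card_Icc_two_mul_add_two]
  exact card_add_card_le_choose_two (by rw [card_Icc_two_mul_add_two]; omega)
    (traceLink_subset_powersetCard_two hF.2.1 hA)
    (traceLink_sdiff_subset_powersetCard_one hF.2.1 hA)
    (crossIntersecting_traceLink hF.2.2 disjoint_sdiff)

theorem traceLink_eq_powersetCard_two (hm : 2 * s + 5 ≤ m)
    (hF : IsMNKIntersecting m (2 * s + 1) (s + 2) F)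
    (hA : A ∈ powersetCard s (Icc 1 (2 * s + 1)))
    (h : traceWeight F (Icc 1 (2 * s + 1)) A = (m - (2 * s + 1)).choose 2) :
    traceLink F (Icc 1 (2 * s + 1)) A = powersetCard 2 (Icc (2 * s + 2) m) :=
  eq_powersetCard_two_of_card_add_card_eq (by rw [card_Icc_two_mul_add_two]; omega)
    (traceLink_subset_powersetCard_two hF.2.1 hA)
    (traceLink_sdiff_subset_powersetCard_one hF.2.1 hA)
    (crossIntersecting_traceLink hF.2.2 disjoint_sdiff) (by rw [card_Icc_two_mul_add_two]; exact h)

/-- The `s`-subsets of `[2s+1]` whose trace weight exceeds `m - (2s+1)`, the value shared by the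
`s`-sets avoiding `t` in the extremal family `mnkH m (2s+1) (s+2) t`. -/
def heavyTraces (m s : ℕ) (F : Finset (Finset ℕ)) : Finset (Finset ℕ) :=
  {A ∈ powersetCard s (Icc 1 (2 * s + 1)) | m - (2 * s + 1) < traceWeight F (Icc 1 (2 * s + 1)) A}

theorem intersecting_heavyTraces (hm : 2 * s + 5 ≤ m)
    (hF : IsMNKIntersecting m (2 * s + 1) (s + 2) F) :
    (heavyTraces m s F : Set (Finset ℕ)).Intersecting := by
  intro A hA B hB hAB
  obtain ⟨hAs, hA⟩ := mem_filter.1 hA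
  obtain ⟨hBs, hB⟩ := mem_filter.1 hB
  rw [← card_Icc_two_mul_add_two] at hA hB
  rcases card_add_card_le_of_crossIntersecting (by rw [card_Icc_two_mul_add_two]; omega)
    (traceLink_subset_powersetCard_two hF.2.1 hAs) (traceLink_subset_powersetCard_two hF.2.1 hBs)
    (traceLink_sdiff_subset_powersetCard_one hF.2.1 hAs)
    (traceLink_sdiff_subset_powersetCard_one hF.2.1 hBs)
    (crossIntersecting_traceLink hF.2.2 disjoint_sdiff)
    (crossIntersecting_traceLink hF.2.2 disjoint_sdiff)
    (crossIntersecting_traceLink hF.2.2 hAB) with h | h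
  · exact hA.not_ge h
  · exact hB.not_ge h

theorem card_heavyTraces_le (hm : 2 * s + 5 ≤ m)
    (hF : IsMNKIntersecting m (2 * s + 1) (s + 2) F) :
    #(heavyTraces m s F) ≤ (2 * s).choose (s - 1) := by
  have hcU : #(Icc 1 (2 * s + 1)) = 2 * s + 1 := by simp
  have h := card_le_choose_of_intersecting (intersecting_heavyTraces hm hF)
    (filter_subset _ (powersetCard s (Icc 1 (2 * s + 1)))) (by omega)
  rwa [hcU, Nat.add_sub_cancel] at h

theorem mnkh_two_mul_add_one (hs : 0 < s) (hm : 2 * s + 5 ≤ m) :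
    mnkh m (2 * s + 1) (s + 2) = (2 * s + 1).choose (s + 2) +
      (#(powersetCard s (Icc 1 (2 * s + 1))) * (m - (2 * s + 1)) +
        (2 * s).choose (s - 1) * ((m - (2 * s + 1)).choose 2 - (m - (2 * s + 1)))) := by
  have hIcc : Icc 1 (2 * (s + 2) - (2 * s + 1) - 1) = {1, 2} := by
    rw [show 2 * (s + 2) - (2 * s + 1) - 1 = 2 by omega]
    rfl
  have hpascal : (2 * s + 1).choose s = (2 * s).choose (s - 1) + (2 * s).choose s := by
    obtain ⟨r, rfl⟩ := Nat.exists_eq_add_of_le' hs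
    exact Nat.choose_succ_succ _ _
  have hN := (lt_choose_two (n := m - (2 * s + 1)) (by omega)).le
  have hU : #(powersetCard s (Icc 1 (2 * s + 1))) = (2 * s).choose (s - 1) + (2 * s).choose s := by
    rw [card_powersetCard, Nat.card_Icc, Nat.add_sub_cancel, hpascal]
  rw [mnkh, hIcc, sum_pair (by decide), hU, Nat.choose_one_right]
  change _ + ((2 * s).choose s * _ + (2 * s).choose (s - 1) * _) = _
  obtain ⟨d, hd⟩ := Nat.exists_eq_add_of_le hN
  rw [hd, Nat.add_sub_cancel_left]
  ring

theorem card_le_mnkh (hs : 0 < s) (hm : 2 * s + 5 ≤ m)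
    (hF : IsMNKIntersecting m (2 * s + 1) (s + 2) F) : #F ≤ mnkh m (2 * s + 1) (s + 2) := by
  have hN : m - (2 * s + 1) ≤ (m - (2 * s + 1)).choose 2 := (lt_choose_two (by omega)).le
  rw [mnkh_two_mul_add_one hs hm]
  refine (card_le_choose_add_sum_traceWeight hs hF).trans (Nat.add_le_add_left ?_ _)
  refine sum_le_of_card_filter_lt_le (fun A hA => ?_) (card_heavyTraces_le hm hF)
  rw [Nat.add_sub_cancel' hN]
  exact traceWeight_le_choose_two hm hF hA

theorem exists_forall_traceLink_eq_powersetCard_two (hs : 0 < s) (hm : 2 * s + 5 ≤ m)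
    (hF : IsMNKIntersecting m (2 * s + 1) (s + 2) F)
    (hcard : #F = mnkh m (2 * s + 1) (s + 2)) :
    ∃ t ∈ Icc 1 (2 * s + 1), ∀ A ∈ powersetCard s (Icc 1 (2 * s + 1)), t ∈ A →
      traceLink F (Icc 1 (2 * s + 1)) A = powersetCard 2 (Icc (2 * s + 2) m) := by
  have hN : m - (2 * s + 1) < (m - (2 * s + 1)).choose 2 := lt_choose_two (by omega)
  have hw : ∀ A ∈ powersetCard s (Icc 1 (2 * s + 1)), traceWeight F (Icc 1 (2 * s + 1)) A ≤
      m - (2 * s + 1) + ((m - (2 * s + 1)).choose 2 - (m - (2 * s + 1))) := fun A hA => by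
    rw [Nat.add_sub_cancel' hN.le]
    exact traceWeight_le_choose_two hm hF hA
  have hsum := card_le_choose_add_sum_traceWeight hs hF
  rw [hcard, mnkh_two_mul_add_one hs hm, Nat.add_le_add_iff_left] at hsum
  have hheavy := card_heavyTraces_le hm hF
  obtain ⟨t, ht, hstar⟩ := exists_eq_filter_mem_of_card_eq_choose hs (by simp)
    (intersecting_heavyTraces hm hF) (filter_subset _ _)
    (card_filter_lt_eq_of_le_sum hw (Nat.sub_pos_of_lt hN) hheavy hsum)
  refine ⟨t, ht, fun A hA htA => traceLink_eq_powersetCard_two hm hF hA ?_⟩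
  have hAheavy : A ∈ heavyTraces m s F := hstar ▸ mem_filter.2 ⟨hA, htA⟩
  rw [eq_add_of_le_sum hw hheavy hsum hA (mem_filter.1 hAheavy).2, Nat.add_sub_cancel' hN.le]

theorem subset_mnkH_of_forall_traceLink_eq (hs : 0 < s) (hm : 2 * s + 5 ≤ m)
    (hF : IsMNKIntersecting m (2 * s + 1) (s + 2) F) (ht : t ∈ Icc 1 (2 * s + 1))
    (hlink : ∀ A ∈ powersetCard s (Icc 1 (2 * s + 1)), t ∈ A →
      traceLink F (Icc 1 (2 * s + 1)) A = powersetCard 2 (Icc (2 * s + 2) m)) :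
    F ⊆ mnkH m (2 * s + 1) (s + 2) t := by
  intro f hf
  have hlt := lt_add_card_inter_of_mem hF hf
  obtain ⟨hfm, hfk⟩ := mem_powersetCard.1 (hF.2.1 hf)
  refine (mem_mnkH ht (by omega) (by omega)).2
    ⟨hF.2.1 hf, or_iff_not_imp_left.2 fun hfU => ⟨?_, hlt⟩⟩
  by_contra htf
  -- The link of an `s`-set `B ∋ t` avoiding `f` contains a pair `e` avoiding `f`.
  have hcard := card_sdiff_add_card_inter f (Icc 1 (2 * s + 1))
  have hpos := (sdiff_nonempty.2 hfU).card_pos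
  have hs_le : s ≤ #(Icc 1 (2 * s + 1) \ f) := by
    rw [card_sdiff, Nat.card_Icc]
    omega
  have htwo_le : 2 ≤ #(Icc (2 * s + 2) m \ (f \ Icc 1 (2 * s + 1))) := by
    rw [card_sdiff_of_subset (sdiff_Icc_subset hfm), card_Icc_two_mul_add_two]
    omega
  obtain ⟨B, htB, hB, hBs⟩ := exists_subsuperset_card_eq
    (singleton_subset_iff.2 (mem_sdiff.2 ⟨ht, htf⟩)) (by rwa [card_singleton]) hs_le
  obtain ⟨e, he, he2⟩ := exists_subset_card_eq htwo_le
  have hBe : e ∈ traceLink F (Icc 1 (2 * s + 1)) B := by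
    rw [hlink B (mem_powersetCard.2 ⟨hB.trans sdiff_subset, hBs⟩) (singleton_subset_iff.1 htB)]
    exact mem_powersetCard.2 ⟨he.trans sdiff_subset, he2⟩
  have hdisj : Disjoint (f ∩ Icc 1 (2 * s + 1)) B :=
    (disjoint_sdiff.mono_right hB).mono_left inter_subset_left
  exact crossIntersecting_traceLink hF.2.2 hdisj (sdiff_mem_traceLink hf) hBe
    (disjoint_sdiff.mono_right he)

end Extremal

theorem theorem11 (m n k : ℕ) (hkn : k ≤ n) (hkm : 2 * k < m) (hn : n + 3 = 2 * k) :
    mnkAlpha m n k = mnkh m n k ∧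
      ∀ F : Finset (Finset ℕ), IsMaximumMNK m n k F → ∃ t ∈ Icc 1 n, F = mnkH m n k t := by
  obtain ⟨s, rfl⟩ : ∃ s, k = s + 2 := ⟨k - 2, by omega⟩
  obtain rfl : n = 2 * s + 1 := by omega
  have hs : 0 < s := by omega
  have hm : 2 * s + 5 ≤ m := by omega
  have h1 : 1 ∈ Icc 1 (2 * s + 1) := by simp
  have hα : mnkAlpha m (2 * s + 1) (s + 2) = mnkh m (2 * s + 1) (s + 2) := by
    refine (mnkAlpha_le fun F hF => card_le_mnkh hs hm hF).antisymm ?_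
    rw [← card_mnkH h1]
    exact (isMNKIntersecting_mnkH h1 hkn (by omega) (by omega)).card_le_mnkAlpha
  refine ⟨hα, fun F ⟨hF, hFα⟩ => ?_⟩
  have hcard : #F = mnkh m (2 * s + 1) (s + 2) := hFα.trans hα
  obtain ⟨t, ht, hlink⟩ := exists_forall_traceLink_eq_powersetCard_two hs hm hF hcard
  have hsub := subset_mnkH_of_forall_traceLink_eq hs hm hF ht hlink
  exact ⟨t, ht, eq_of_subset_of_card_le hsub (by rw [card_mnkH ht, hcard])⟩
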